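/- Let $k$ be an algebraically closed field of characteristic $0$, let $f \in k[x_1,\dots,x_d]$ be a polynomial of total degree at least $2$, and let $A = k[x_1,\dots,x_d]/(f)$. Let $\mathrm{HH}^2(A)$ be the second Hochschild cohomology of the $k$-algebra $A$ with coefficients in $A$, i.e. the module of Hochschild $2$-cocycles (the $k$-bilinear maps $\psi\colon A\times A\to A$ with $a\psi(b,c)-\psi(ab,c)+\psi(a,bc)-\psi(a,b)c=0$ for all $a,b,c \in A$) modulo the $2$-coboundaries (the maps $(a,b)\mapsto a\varphi(b)-\varphi(ab)+\varphi(a)b$ with $\varphi\colon A\to A$ $k$-linear), on which $A$ acts by multiplication of values. Then there is an isomorphism of $A$-modules (in particular of $k$-vector spaces) $$\mathrm{HH}^2(A)\;\cong\; A\Big/\Big(\frac{\partial f}{\partial x_1},\dots,\frac{\partial f}{\partial x_d}\Big)\;\oplus\;\mathcal N,$$ where $\mathcal N$ is the $A$-module of families $(a_{ji})_{1\le i,j\le d}$ of elements of $A$ with $a_{ji}=0$ whenever $j\le i$, such that $$\sum_{i=1}^d (a_{mi}-a_{im})\,\frac{\partial f}{\partial x_i}=0\ \text{ in } A\qquad\text{for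 each } 1\le m\le d.$$ -/

import Mathlib

namespace HypersurfaceHH

section Hochschild

variable (k : Type*) (A : Type*) [CommRing k] [CommRing A] [Algebra k A]

/-- A function `ψ : A × A → A` is a Hochschild cochain of degree two, that is, a `k`-linear map
`A ⊗ A → A`, if it is `k`-bilinear. -/
def IsCochain2 (ψ : A → A → A) : Prop :=
  (∀ a, IsLinearMap k (fun b => ψ a b)) ∧ ∀ b, IsLinearMap k (fun a => ψ a b)

variable {A} in
/-- The Hochschild differential of a cochain of degree one,
`(d φ)(a, b) = a φ(b) - φ(a b) + φ(a) b`. -/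
def hochschildD1 (φ : A → A) (a b : A) : A := a * φ b - φ (a * b) + φ a * b

variable {A} in
/-- The Hochschild differential of a cochain of degree two,
`(d ψ)(a, b, c) = a ψ(b, c) - ψ(a b, c) + ψ(a, b c) - ψ(a, b) c`. -/
def hochschildD2 (ψ : A → A → A) (a b c : A) : A :=
  a * ψ b c - ψ (a * b) c + ψ a (b * c) - ψ a b * c

/-- The Hochschild `2`-cocycles of `A` with values in `A`. As `A` is commutative, they form an
`A`-module, on which `A` acts by multiplication of the values. -/
def cocycle2 : Submodule A (A → A → A) where
  carrier := {ψ | IsCochain2 k A ψ ∧ ∀ a b c, hochschildD2 ψ a b c = 0}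
  zero_mem' := by
    refine ⟨⟨fun a => ⟨fun _ _ => ?_, fun _ _ => ?_⟩, fun b => ⟨fun _ _ => ?_, fun _ _ => ?_⟩⟩,
      fun a b c => ?_⟩ <;> simp [hochschildD2]
  add_mem' := by
    rintro φ ψ ⟨⟨h1, h2⟩, h3⟩ ⟨⟨g1, g2⟩, g3⟩
    refine ⟨⟨fun a => (h1 a).mk' _ + (g1 a).mk' _ |>.isLinear,
      fun b => (h2 b).mk' _ + (g2 b).mk' _ |>.isLinear⟩, fun a b c => ?_⟩
    have h := h3 a b c
    have g := g3 a b c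
    simp only [hochschildD2, Pi.add_apply] at h g ⊢
    linear_combination h + g
  smul_mem' := by
    rintro r φ ⟨⟨h1, h2⟩, h3⟩
    refine ⟨⟨fun a => r • (h1 a).mk' _ |>.isLinear, fun b => r • (h2 b).mk' _ |>.isLinear⟩,
      fun a b c => ?_⟩
    have h := h3 a b c
    simp only [hochschildD2, Pi.smul_apply, smul_eq_mul] at h ⊢
    linear_combination r * h

/-- The Hochschild `2`-coboundaries of `A` with values in `A`: the differentials of the
`k`-linear maps `A → A`. -/
def coboundary2 : Submodule A (A → A → A) where
  carrier := {ψ | ∃ φ : A →ₗ[k] A, ψ = hochschildD1 φ}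
  zero_mem' := ⟨0, by funext a b; simp [hochschildD1]⟩
  add_mem' := by
    rintro _ _ ⟨φ, rfl⟩ ⟨ψ, rfl⟩
    refine ⟨φ + ψ, ?_⟩
    funext a b
    simp only [hochschildD1, Pi.add_apply, LinearMap.add_apply]
    ring
  smul_mem' := by
    rintro r _ ⟨φ, rfl⟩
    refine ⟨r • φ, ?_⟩
    funext a b
    simp only [hochschildD1, Pi.smul_apply, LinearMap.smul_apply, smul_eq_mul]
    ring

theorem coboundary2_le_cocycle2 : coboundary2 k A ≤ cocycle2 k A := by
  rintro _ ⟨φ, rfl⟩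
  refine ⟨⟨fun a => ⟨fun b c => ?_, fun r b => ?_⟩, fun b => ⟨fun a c => ?_, fun r a => ?_⟩⟩,
    fun a b c => ?_⟩
  · simp only [hochschildD1, mul_add, map_add]; ring
  · simp only [hochschildD1, mul_smul_comm, map_smul, smul_add, smul_sub]
  · simp only [hochschildD1, add_mul, map_add]; ring
  · simp only [hochschildD1, smul_mul_assoc, map_smul, smul_add, smul_sub]
  · simp only [hochschildD1, hochschildD2, mul_assoc]; ring

/-- The second Hochschild cohomology `HH²(A) = HH²(A, A)` of the commutative `k`-algebra `A`, as
an `A`-module: Hochschild `2`-cocycles modulo Hochschild `2`-coboundaries. -/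
abbrev HH2 : Type _ := cocycle2 k A ⧸ (coboundary2 k A).submoduleOf (cocycle2 k A)

end Hochschild

section Hypersurface

variable {k : Type*} [Field k] {d : ℕ} (f : MvPolynomial (Fin d) k)

/-- The coordinate ring `A = k[x_1, …, x_d] / (f)` of the affine hypersurface `f = 0`. -/
abbrev CoordRing := MvPolynomial (Fin d) k ⧸ Ideal.span {f}

/-- The class in `A` of the partial derivative `∂f/∂x_i`. -/
noncomputable def partialClass (i : Fin d) : CoordRing f :=
  Ideal.Quotient.mk (Ideal.span {f}) (MvPolynomial.pderiv i f)

/-- The ideal `(∂f/∂x_1, …, ∂f/∂x_d)` of `A`. -/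
noncomputable def jacobianIdeal : Ideal (CoordRing f) := Ideal.span (Set.range (partialClass f))

/-- The `A`-module of families `(a_{ji})` with `a_{ji} = 0` for `j ≤ i` and
`∑ i, (a_{mi} - a_{im}) ∂f/∂x_i = 0` in `A` for every `m`. -/
noncomputable def moduleN : Submodule (CoordRing f) (Fin d → Fin d → CoordRing f) where
  carrier := {a | (∀ j i, j ≤ i → a j i = 0) ∧
    ∀ m, ∑ i, (a m i - a i m) * partialClass f i = 0}
  add_mem' := by
    rintro a b ⟨ha, ha'⟩ ⟨hb, hb'⟩
    refine ⟨fun j i h => by simp [ha j i h, hb j i h], fun m => ?_⟩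
    rw [← add_zero (0 : CoordRing f)]
    nth_rewrite 1 [← ha' m]
    rw [← hb' m, ← Finset.sum_add_distrib]
    refine Finset.sum_congr rfl fun i _ => ?_
    simp only [Pi.add_apply]
    ring
  zero_mem' := ⟨fun _ _ _ => rfl, fun m => by simp⟩
  smul_mem' := by
    rintro r a ⟨ha, ha'⟩
    refine ⟨fun j i h => by simp [ha j i h], fun m => ?_⟩
    rw [← mul_zero r, ← ha' m, Finset.mul_sum]
    refine Finset.sum_congr rfl fun i _ => ?_
    simp only [Pi.smul_apply, smul_eq_mul]
    ring

end Hypersurface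

end HypersurfaceHH

/-! Since 2 is invertible, a cocycle splits into a symmetric and an alternating part. Let `P` be the
polynomial ring. A symmetric cocycle is a commutative square-zero extension of `A`. Pulled back to
`P` it splits, because `P` is free, so there it is the differential of a linear `φ : P → A`, unique
up to a derivation. Derivations `P → A` take at `f` exactly the values in the Jacobian ideal, so the
class of `φ f` is well defined; it vanishes iff some `φ` descends to `A`, i.e. iff the cocycle is a
coboundary. The antisymmetrization of a cocycle is a biderivation of `A`. It is given by its matrix
on the coordinates, and descending to `A` is the relation defining `moduleN`. The pair
`obstructionClass`, `antisymmPart` is thus onto (`exists_symmetric_cocycle`,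
`exists_alternating_cocycle`), with the coboundaries as kernel (`mem_ker_iff_mem_coboundary2`). -/

namespace HypersurfaceHH

/-! ### Square-zero extensions and symmetric cocycles. -/

section SquareZero

variable (k : Type*) (A : Type*) [CommRing k] [CommRing A] [Algebra k A]

/-- A Hochschild `2`-cocycle of `A` which is symmetric in its two arguments. -/
structure SymmCocycle2 where
  toFun : A → A → A
  mem : toFun ∈ cocycle2 k A
  symm : ∀ a b, toFun a b = toFun b a

variable {k A}

theorem add_right_of_mem_cocycle2 {ψ : A → A → A} (h : ψ ∈ cocycle2 k A) (a b c : A) :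
    ψ a (b + c) = ψ a b + ψ a c := (h.1.1 a).map_add b c

theorem smul_left_of_mem_cocycle2 {ψ : A → A → A} (h : ψ ∈ cocycle2 k A) (r : k) (a b : A) :
    ψ (r • a) b = r • ψ a b := (h.1.2 b).map_smul r a

theorem hochschildD2_of_mem_cocycle2 {ψ : A → A → A} (h : ψ ∈ cocycle2 k A) (a b c : A) :
    a * ψ b c - ψ (a * b) c + ψ a (b * c) - ψ a b * c = 0 := h.2 a b c

/-- The underlying `k`-module `A × A` of the commutative square-zero extension of `A` by `A`
defined by a symmetric cocycle. -/
def SquareZeroExt (_ψ : SymmCocycle2 k A) : Type _ := A × A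

namespace SquareZeroExt

variable (ψ : SymmCocycle2 k A)

instance : AddCommGroup (SquareZeroExt ψ) := inferInstanceAs (AddCommGroup (A × A))

instance : Module k (SquareZeroExt ψ) := inferInstanceAs (Module k (A × A))

instance : Mul (SquareZeroExt ψ) :=
  ⟨fun x y => (x.1 * y.1, x.1 * y.2 + y.1 * x.2 + ψ.toFun x.1 y.1)⟩

/-- Cocycles need not be normalized; since `ψ(1, a) = ψ(1, 1) a`, this correction is what gives a
unit. -/
instance : One (SquareZeroExt ψ) := ⟨(1, -ψ.toFun 1 1)⟩

variable {ψ}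

@[ext] theorem ext {x y : SquareZeroExt ψ} (h₁ : x.1 = y.1) (h₂ : x.2 = y.2) : x = y :=
  Prod.ext h₁ h₂

@[simp] theorem fst_add (x y : SquareZeroExt ψ) : (x + y).1 = x.1 + y.1 := rfl
@[simp] theorem snd_add (x y : SquareZeroExt ψ) : (x + y).2 = x.2 + y.2 := rfl
@[simp] theorem fst_smul (r : k) (x : SquareZeroExt ψ) : (r • x).1 = r • x.1 := rfl
@[simp] theorem snd_smul (r : k) (x : SquareZeroExt ψ) : (r • x).2 = r • x.2 := rfl
@[simp] theorem fst_one : (1 : SquareZeroExt ψ).1 = 1 := rfl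
@[simp] theorem snd_one : (1 : SquareZeroExt ψ).2 = -ψ.toFun 1 1 := rfl
@[simp] theorem fst_mul (x y : SquareZeroExt ψ) : (x * y).1 = x.1 * y.1 := rfl
@[simp] theorem snd_mul (x y : SquareZeroExt ψ) :
    (x * y).2 = x.1 * y.2 + y.1 * x.2 + ψ.toFun x.1 y.1 := rfl

protected theorem mul_comm (x y : SquareZeroExt ψ) : x * y = y * x := by
  ext
  · simp [mul_comm]
  · simp only [snd_mul, ψ.symm x.1 y.1]; ring

protected theorem one_mul (x : SquareZeroExt ψ) : 1 * x = x := by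
  ext
  · simp
  · have h := hochschildD2_of_mem_cocycle2 ψ.mem 1 1 x.1
    simp only [one_mul] at h
    simp only [snd_mul, fst_one, snd_one]
    linear_combination h

protected theorem mul_add (x y z : SquareZeroExt ψ) : x * (y + z) = x * y + x * z := by
  ext
  · simp [mul_add]
  · simp only [snd_mul, fst_add, snd_add, add_right_of_mem_cocycle2 ψ.mem]; ring

instance : CommRing (SquareZeroExt ψ) :=
  { (inferInstance : AddCommGroup (SquareZeroExt ψ)), (inferInstance : Mul (SquareZeroExt ψ)),
    (inferInstance : One (SquareZeroExt ψ)) with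
    mul_comm := SquareZeroExt.mul_comm
    one_mul := SquareZeroExt.one_mul
    mul_one x := by rw [SquareZeroExt.mul_comm, SquareZeroExt.one_mul]
    left_distrib := SquareZeroExt.mul_add
    right_distrib x y z := by
      rw [SquareZeroExt.mul_comm, SquareZeroExt.mul_add, SquareZeroExt.mul_comm z x,
        SquareZeroExt.mul_comm z y]
    zero_mul x := by
      have h := SquareZeroExt.mul_add x 0 0
      rw [SquareZeroExt.mul_comm]
      simpa only [add_zero, left_eq_add] using h
    mul_zero x := by
      have h := SquareZeroExt.mul_add x 0 0
      simpa only [add_zero, left_eq_add] using h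
    mul_assoc x y z := by
      ext
      · simp [mul_assoc]
      · simp only [snd_mul, fst_mul]
        linear_combination -hochschildD2_of_mem_cocycle2 ψ.mem x.1 y.1 z.1 }

theorem smul_mul (r : k) (x y : SquareZeroExt ψ) : r • x * y = r • (x * y) := by
  ext
  · simp
  · simp only [snd_mul, fst_smul, snd_smul, smul_left_of_mem_cocycle2 ψ.mem, smul_add,
      smul_mul_assoc, mul_smul_comm]

instance : Algebra k (SquareZeroExt ψ) :=
  Algebra.ofModule smul_mul fun r x y => by rw [mul_comm, smul_mul, mul_comm]

variable (ψ) in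
/-- The projection of a square-zero extension onto `A`. -/
def fstHom : SquareZeroExt ψ →ₐ[k] A :=
  AlgHom.ofLinearMap (LinearMap.fst k A A) rfl fun _ _ => rfl

end SquareZeroExt

/-- The pullback of a symmetric Hochschild `2`-cocycle to a polynomial ring is a coboundary. -/
theorem SymmCocycle2.exists_primitive {σ : Type*} (ψ : SymmCocycle2 k A)
    (π : MvPolynomial σ k →ₐ[k] A) :
    ∃ φ : MvPolynomial σ k →ₗ[k] A,
      ∀ p q, ψ.toFun (π p) (π q) = π p * φ q - φ (p * q) + φ p * π q := by
  -- Any lifts of the `π (X i)` extend to an algebra map `s` over `π`; the second coordinate 0 is an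
  -- arbitrary choice. Multiplicativity of `s` makes minus its second coordinate a primitive.
  let x : σ → SquareZeroExt ψ := fun i => (π (MvPolynomial.X i), 0)
  let s : MvPolynomial σ k →ₐ[k] SquareZeroExt ψ := MvPolynomial.aeval x
  have hs : (SquareZeroExt.fstHom ψ).comp s = π := by
    refine MvPolynomial.algHom_ext fun i => ?_
    change SquareZeroExt.fstHom ψ (MvPolynomial.aeval x (MvPolynomial.X i)) = _
    rw [MvPolynomial.aeval_X]
    rfl
  have hs' (p) : (s p).1 = π p := congrArg (fun F => F p) hs
  refine ⟨-(LinearMap.snd k A A ∘ₗ s.toLinearMap), fun p q => ?_⟩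
  change _ = π p * -(s q).2 - -(s (p * q)).2 + -(s p).2 * π q
  rw [map_mul, SquareZeroExt.snd_mul, hs', hs']
  ring

/-- The antisymmetrization of a Hochschild `2`-cocycle of a commutative algebra is a derivation in
its second argument. -/
theorem antisymm_mul_of_mem_cocycle2 {ψ : A → A → A} (h : ψ ∈ cocycle2 k A) (a b c : A) :
    ψ a (b * c) - ψ (b * c) a = b * (ψ a c - ψ c a) + c * (ψ a b - ψ b a) := by
  have h₁ := hochschildD2_of_mem_cocycle2 h a b c
  have h₂ := hochschildD2_of_mem_cocycle2 h b a c
  have h₃ := hochschildD2_of_mem_cocycle2 h b c a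
  rw [mul_comm b a] at h₂
  rw [mul_comm c a] at h₃
  -- The alternating sum runs over the three positions of `a` relative to `b, c`.
  linear_combination h₁ - h₂ + h₃

/-- The opposite of a Hochschild `2`-cocycle of a commutative algebra is a cocycle. -/
theorem swap_mem_cocycle2 {ψ : A → A → A} (h : ψ ∈ cocycle2 k A) :
    (fun a b => ψ b a) ∈ cocycle2 k A := by
  refine ⟨⟨h.1.2, h.1.1⟩, fun a b c => ?_⟩
  have := hochschildD2_of_mem_cocycle2 h c b a
  rw [mul_comm c b, mul_comm b a] at this
  simp only [hochschildD2]
  linear_combination -this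

/-- The symmetrization of a Hochschild `2`-cocycle. -/
def symmetrization {ψ : A → A → A} (h : ψ ∈ cocycle2 k A) : SymmCocycle2 k A where
  toFun := ψ + fun a b => ψ b a
  mem := add_mem h (swap_mem_cocycle2 h)
  symm _ _ := add_comm _ _

end SquareZero

/-- A derivation on a polynomial ring is determined by the chain rule. -/
theorem derivation_eq_sum_pderiv {k M σ : Type*} [CommRing k] [Fintype σ] [AddCommGroup M]
    [Module k M] [Module (MvPolynomial σ k) M] [IsScalarTower k (MvPolynomial σ k) M]
    (D : Derivation k (MvPolynomial σ k) M) (p : MvPolynomial σ k) :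
    D p = ∑ i, MvPolynomial.pderiv i p • D (MvPolynomial.X i) := by
  classical
  let E : Derivation k (MvPolynomial σ k) M := Derivation.mk'
    (∑ i, (((LinearMap.toSpanSingleton (MvPolynomial σ k) M (D (MvPolynomial.X i))).compDer
      (MvPolynomial.pderiv i) : Derivation k (MvPolynomial σ k) M) :
        MvPolynomial σ k →ₗ[k] M)) fun a b => by
      simp [Finset.sum_add_distrib, Finset.smul_sum, add_smul, mul_smul]
  have hE (q) : E q = ∑ i, MvPolynomial.pderiv i q • D (MvPolynomial.X i) := by
    simp [E]
  rw [← hE]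
  congr 1
  refine MvPolynomial.derivation_ext fun j => ?_
  rw [hE]
  simp [MvPolynomial.pderiv_X, Pi.single_apply]

end HypersurfaceHH

namespace HypersurfaceHH

/-! ### Derivations from the polynomial ring to `A` and their values at `f`. -/

section Hypersurface

open MvPolynomial

variable {k : Type*} [Field k] {d : ℕ} (f : MvPolynomial (Fin d) k)

/-- The quotient map from the polynomial ring to the coordinate ring. -/
noncomputable abbrev toCoordRing : MvPolynomial (Fin d) k →ₐ[k] CoordRing f :=
  Ideal.Quotient.mkₐ k (Ideal.span {f})

theorem toCoordRing_surjective : Function.Surjective (toCoordRing f) :=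
  Ideal.Quotient.mkₐ_surjective k _

theorem toCoordRing_self : toCoordRing f f = 0 :=
  Ideal.Quotient.eq_zero_iff_mem.2 (Ideal.mem_span_singleton_self f)

theorem toCoordRing_eq_iff {p q : MvPolynomial (Fin d) k} :
    toCoordRing f p = toCoordRing f q ↔ ∃ r, p = q + r * f := by
  rw [Ideal.Quotient.mkₐ_eq_mk, Ideal.Quotient.mk_eq_mk_iff_sub_mem, Ideal.mem_span_singleton']
  exact exists_congr fun r => by rw [eq_sub_iff_add_eq', eq_comm]

theorem smul_eq_toCoordRing_mul (p : MvPolynomial (Fin d) k) (a : CoordRing f) :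
    p • a = toCoordRing f p * a := Algebra.smul_def p a

theorem derivation_eq_sum_toCoordRing (D : Derivation k (MvPolynomial (Fin d) k) (CoordRing f))
    (p : MvPolynomial (Fin d) k) : D p = ∑ i, D (X i) * toCoordRing f (pderiv i p) := by
  rw [derivation_eq_sum_pderiv]
  exact Finset.sum_congr rfl fun i _ => by rw [smul_eq_toCoordRing_mul, mul_comm]

theorem derivation_self_mem_jacobianIdeal
    (D : Derivation k (MvPolynomial (Fin d) k) (CoordRing f)) : D f ∈ jacobianIdeal f := by
  rw [derivation_eq_sum_toCoordRing]
  exact Ideal.sum_mem _ fun i _ => Ideal.mul_mem_left _ _ (Ideal.subset_span ⟨i, rfl⟩)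

theorem exists_derivation_self_eq {a : CoordRing f} (ha : a ∈ jacobianIdeal f) :
    ∃ D : Derivation k (MvPolynomial (Fin d) k) (CoordRing f), D f = a := by
  obtain ⟨c, rfl⟩ := (Ideal.mem_span_range_iff_exists_fun).1 ha
  refine ⟨mkDerivation k c, ?_⟩
  rw [derivation_eq_sum_toCoordRing]
  exact Finset.sum_congr rfl fun i _ => by rw [mkDerivation_X]; rfl

variable {f}

/-! ### Primitives and the obstruction class. -/

/-- `φ` is a primitive, on the polynomial ring, of the symmetrization of `ψ`. -/
def IsSymmPrimitive (ψ : CoordRing f → CoordRing f → CoordRing f)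
    (φ : MvPolynomial (Fin d) k →ₗ[k] CoordRing f) : Prop :=
  ∀ p q, ψ (toCoordRing f p) (toCoordRing f q) + ψ (toCoordRing f q) (toCoordRing f p) =
    toCoordRing f p * φ q - φ (p * q) + φ p * toCoordRing f q

theorem exists_isSymmPrimitive {ψ : CoordRing f → CoordRing f → CoordRing f}
    (h : ψ ∈ cocycle2 k (CoordRing f)) : ∃ φ, IsSymmPrimitive ψ φ :=
  (symmetrization h).exists_primitive (toCoordRing f)

namespace IsSymmPrimitive

variable {ψ ψ' : CoordRing f → CoordRing f → CoordRing f}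
  {φ φ' : MvPolynomial (Fin d) k →ₗ[k] CoordRing f}

theorem add (h : IsSymmPrimitive ψ φ) (h' : IsSymmPrimitive ψ' φ') :
    IsSymmPrimitive (ψ + ψ') (φ + φ') := fun p q => by
  simp only [Pi.add_apply, LinearMap.add_apply]
  linear_combination h p q + h' p q

theorem smul (a : CoordRing f) (h : IsSymmPrimitive ψ φ) :
    IsSymmPrimitive (a • ψ) (a • φ) := fun p q => by
  simp only [Pi.smul_apply, LinearMap.smul_apply, smul_eq_mul]
  linear_combination a * h p q

theorem sub_derivation (h : IsSymmPrimitive ψ φ)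
    (D : Derivation k (MvPolynomial (Fin d) k) (CoordRing f)) :
    IsSymmPrimitive ψ (φ - D) := fun p q => by
  have hD := D.leibniz p q
  rw [smul_eq_toCoordRing_mul, smul_eq_toCoordRing_mul] at hD
  simp only [LinearMap.sub_apply, Derivation.coeFn_coe]
  linear_combination h p q - hD

/-- Two primitives of the same cocycle differ by a derivation; this makes the obstruction class
independent of choices. -/
theorem sub_mem_jacobianIdeal (h : IsSymmPrimitive ψ φ) (h' : IsSymmPrimitive ψ φ') :
    φ f - φ' f ∈ jacobianIdeal f := by
  refine derivation_self_mem_jacobianIdeal f (Derivation.mk' (φ - φ') fun p q => ?_)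
  rw [smul_eq_toCoordRing_mul, smul_eq_toCoordRing_mul]
  simp only [LinearMap.sub_apply]
  linear_combination h p q - h' p q

/-- As `f` is zero in `A`, the cocycle terms vanish. Hence `φ f = 0` forces `φ` to kill the whole
ideal `(f)` and to descend to `A`. -/
theorem map_mul_self (hψ : ψ ∈ cocycle2 k (CoordRing f)) (h : IsSymmPrimitive ψ φ)
    (p : MvPolynomial (Fin d) k) : φ (p * f) = toCoordRing f p * φ f := by
  have hp := h p f
  rw [toCoordRing_self, (hψ.1.1 _).map_zero, (hψ.1.2 _).map_zero] at hp
  linear_combination hp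

end IsSymmPrimitive

/-- The obstruction class in `A / (∂f)` of a cocycle: the value at `f` of a primitive of its
symmetrization. -/
noncomputable def obstructionClass :
    cocycle2 k (CoordRing f) →ₗ[CoordRing f] CoordRing f ⧸ jacobianIdeal f where
  toFun ψ := Submodule.Quotient.mk ((exists_isSymmPrimitive ψ.2).choose f)
  map_add' ψ ψ' := (Submodule.Quotient.eq _).2 <|
    (exists_isSymmPrimitive (ψ + ψ').2).choose_spec.sub_mem_jacobianIdeal <|
      (exists_isSymmPrimitive ψ.2).choose_spec.add (exists_isSymmPrimitive ψ'.2).choose_spec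
  map_smul' a ψ := (Submodule.Quotient.eq _).2 <|
    (exists_isSymmPrimitive (a • ψ).2).choose_spec.sub_mem_jacobianIdeal <|
      (exists_isSymmPrimitive ψ.2).choose_spec.smul a

theorem obstructionClass_eq (ψ : cocycle2 k (CoordRing f))
    {φ : MvPolynomial (Fin d) k →ₗ[k] CoordRing f} (h : IsSymmPrimitive ψ.1 φ) :
    obstructionClass ψ = Submodule.Quotient.mk (φ f) :=
  (Submodule.Quotient.eq _).2 ((exists_isSymmPrimitive ψ.2).choose_spec.sub_mem_jacobianIdeal h)

theorem obstructionClass_eq_zero_iff (ψ : cocycle2 k (CoordRing f)) :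
    obstructionClass ψ = 0 ↔ ∃ φ, IsSymmPrimitive ψ.1 φ ∧ φ f = 0 := by
  constructor
  · intro h
    obtain ⟨φ, hφ⟩ := exists_isSymmPrimitive ψ.2
    rw [obstructionClass_eq ψ hφ, Submodule.Quotient.mk_eq_zero] at h
    obtain ⟨D, hD⟩ := exists_derivation_self_eq f h
    exact ⟨_, hφ.sub_derivation D, by simp [hD]⟩
  · rintro ⟨φ, hφ, h0⟩
    rw [obstructionClass_eq ψ hφ, h0, Submodule.Quotient.mk_zero]

/-- A cocycle whose obstruction class vanishes has a coboundary as its symmetrization. -/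
theorem obstructionClass_eq_zero_iff_exists_hochschildD1 (ψ : cocycle2 k (CoordRing f)) :
    obstructionClass ψ = 0 ↔
      ∃ φ : CoordRing f →ₗ[k] CoordRing f, ∀ a b, ψ.1 a b + ψ.1 b a = hochschildD1 φ a b := by
  rw [obstructionClass_eq_zero_iff]
  constructor
  · rintro ⟨φ, hφ, h0⟩
    have hdesc : ∃ φ' : CoordRing f →ₗ[k] CoordRing f, ∀ p, φ' (toCoordRing f p) = φ p := by
      have hc (p q) (hpq : toCoordRing f p = toCoordRing f q) : φ p = φ q := by
        obtain ⟨r, rfl⟩ := (toCoordRing_eq_iff f).1 hpq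
        rw [map_add, hφ.map_mul_self ψ.2, h0, mul_zero, add_zero]
      have hs := Function.surjInv_eq (toCoordRing_surjective f)
      refine ⟨⟨⟨fun a => φ (Function.surjInv (toCoordRing_surjective f) a), fun a b => ?_⟩,
        fun r a => ?_⟩, fun p => hc _ _ (hs _)⟩
      · rw [← map_add]
        exact hc _ _ (by rw [map_add, hs, hs, hs])
      · rw [← map_smul]
        exact hc _ _ (by rw [map_smul, hs, hs]; rfl)
    obtain ⟨φ', hφ'⟩ := hdesc
    refine ⟨φ', fun a b => ?_⟩
    obtain ⟨p, rfl⟩ := toCoordRing_surjective f a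
    obtain ⟨q, rfl⟩ := toCoordRing_surjective f b
    rw [hφ, hochschildD1, ← map_mul, hφ', hφ', hφ']
  · rintro ⟨φ, hφ⟩
    refine ⟨φ ∘ₗ (toCoordRing f).toLinearMap, fun p q => ?_, ?_⟩
    · rw [hφ]
      simp only [hochschildD1, LinearMap.comp_apply, AlgHom.toLinearMap_apply, map_mul]
    · rw [LinearMap.comp_apply, AlgHom.toLinearMap_apply, toCoordRing_self, map_zero]

/-! ### The antisymmetric part. -/

/-- The derivation `p ↦ ψ(a, p) - ψ(p, a)` obtained by antisymmetrizing a cocycle. -/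
noncomputable def antisymmDerivation (ψ : cocycle2 k (CoordRing f)) (a : CoordRing f) :
    Derivation k (MvPolynomial (Fin d) k) (CoordRing f) :=
  Derivation.mk' (((ψ.2.1.1 a).mk' _ - (ψ.2.1.2 a).mk' _) ∘ₗ (toCoordRing f).toLinearMap)
    fun p q => by
      rw [smul_eq_toCoordRing_mul, smul_eq_toCoordRing_mul]
      exact (congrArg (fun c => ψ.1 a c - ψ.1 c a) (map_mul (toCoordRing f) p q)).trans
        (antisymm_mul_of_mem_cocycle2 ψ.2 a _ _)

theorem antisymmDerivation_apply (ψ : cocycle2 k (CoordRing f)) (a : CoordRing f)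
    (p : MvPolynomial (Fin d) k) :
    antisymmDerivation ψ a p = ψ.1 a (toCoordRing f p) - ψ.1 (toCoordRing f p) a := rfl

/-- The strictly lower triangular part of the antisymmetrization of a cocycle, evaluated at the
coordinate functions. -/
noncomputable def antisymmCoeff (ψ : CoordRing f → CoordRing f → CoordRing f) (j i : Fin d) :
    CoordRing f :=
  if i < j then ψ (toCoordRing f (X j)) (toCoordRing f (X i)) -
    ψ (toCoordRing f (X i)) (toCoordRing f (X j)) else 0

theorem antisymmCoeff_sub (ψ : CoordRing f → CoordRing f → CoordRing f) (m i : Fin d) :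
    antisymmCoeff ψ m i - antisymmCoeff ψ i m =
      ψ (toCoordRing f (X m)) (toCoordRing f (X i)) -
        ψ (toCoordRing f (X i)) (toCoordRing f (X m)) := by
  unfold antisymmCoeff
  rcases lt_trichotomy i m with h | rfl | h
  · rw [if_pos h, if_neg h.not_gt, sub_zero]
  · simp
  · rw [if_pos h, if_neg h.not_gt, zero_sub, neg_sub]

/-- The derivation attached to `X m` kills `f`, which is zero in `A`; the chain rule turns this into
the `m`-th relation. -/
theorem antisymmCoeff_mem (ψ : cocycle2 k (CoordRing f)) : antisymmCoeff ψ.1 ∈ moduleN f := by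
  refine ⟨fun j i h => if_neg h.not_gt, fun m => ?_⟩
  have h := derivation_eq_sum_toCoordRing f (antisymmDerivation ψ (toCoordRing f (X m))) f
  rw [antisymmDerivation_apply, toCoordRing_self, (ψ.2.1.1 _).map_zero, (ψ.2.1.2 _).map_zero,
    sub_zero] at h
  rw [h]
  exact Finset.sum_congr rfl fun i _ => by rw [antisymmCoeff_sub, antisymmDerivation_apply]; rfl

/-- The map sending a cocycle to the coefficients of its antisymmetrization. -/
noncomputable def antisymmPart : cocycle2 k (CoordRing f) →ₗ[CoordRing f] moduleN f where
  toFun ψ := ⟨antisymmCoeff ψ.1, antisymmCoeff_mem ψ⟩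
  map_add' ψ ψ' := by
    ext j i
    change antisymmCoeff (ψ.1 + ψ'.1) j i = antisymmCoeff ψ.1 j i + antisymmCoeff ψ'.1 j i
    unfold antisymmCoeff
    split_ifs
    · simp only [Pi.add_apply]; ring
    · simp
  map_smul' a ψ := by
    ext j i
    change antisymmCoeff (a • ψ.1) j i = a * antisymmCoeff ψ.1 j i
    unfold antisymmCoeff
    split_ifs
    · simp only [Pi.smul_apply, smul_eq_mul]; ring
    · simp

/-- The antisymmetrization of a cocycle vanishes if and only if the cocycle is symmetric. -/
theorem antisymmPart_eq_zero_iff (ψ : cocycle2 k (CoordRing f)) :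
    antisymmPart ψ = 0 ↔ ∀ a b, ψ.1 a b = ψ.1 b a := by
  constructor
  · intro h
    have hX (i j : Fin d) : ψ.1 (toCoordRing f (X i)) (toCoordRing f (X j)) =
        ψ.1 (toCoordRing f (X j)) (toCoordRing f (X i)) := by
      have h0 : antisymmCoeff ψ.1 = 0 := congrArg Subtype.val h
      have := antisymmCoeff_sub ψ.1 i j
      rw [h0] at this
      exact sub_eq_zero.1 (this.symm.trans (sub_self 0))
    -- The chain rule is applied to one argument at a time: from pairs of coordinates to a
    -- coordinate and an arbitrary element, then to arbitrary pairs.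
    have hXa (i : Fin d) (a : CoordRing f) :
        ψ.1 (toCoordRing f (X i)) a = ψ.1 a (toCoordRing f (X i)) := by
      obtain ⟨p, rfl⟩ := toCoordRing_surjective f a
      rw [← sub_eq_zero, ← antisymmDerivation_apply, derivation_eq_sum_toCoordRing]
      exact Finset.sum_eq_zero fun j _ => by
        rw [antisymmDerivation_apply, hX, sub_self, zero_mul]
    intro a b
    obtain ⟨p, rfl⟩ := toCoordRing_surjective f b
    rw [← sub_eq_zero, ← antisymmDerivation_apply, derivation_eq_sum_toCoordRing]
    exact Finset.sum_eq_zero fun j _ => by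
      rw [antisymmDerivation_apply, hXa, sub_self, zero_mul]
  · intro h
    ext j i
    change antisymmCoeff ψ.1 j i = 0
    unfold antisymmCoeff
    rw [h, sub_self, ite_self]

/-! ### Kernel and image of the pair of invariants. -/

theorem mem_ker_iff_mem_coboundary2 [CharZero k] (ψ : cocycle2 k (CoordRing f)) :
    ψ ∈ LinearMap.ker (obstructionClass.prod antisymmPart) ↔
      ψ.1 ∈ coboundary2 k (CoordRing f) := by
  rw [LinearMap.mem_ker, LinearMap.prod_apply, Function.prod_apply, Prod.mk_eq_zero,
    obstructionClass_eq_zero_iff_exists_hochschildD1, antisymmPart_eq_zero_iff]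
  -- A symmetric cocycle is half its symmetrization, so a primitive of the latter can be halved.
  have hhalf (a : CoordRing f) : (2⁻¹ : k) • (a + a) = a := by
    rw [← two_smul k a, smul_smul, inv_mul_cancel₀ two_ne_zero, one_smul]
  constructor
  · rintro ⟨⟨φ, hφ⟩, hsymm⟩
    refine ⟨(2⁻¹ : k) • φ, ?_⟩
    funext a b
    have h := hφ a b
    rw [← hsymm a b] at h
    rw [← hhalf (ψ.1 a b), h]
    simp only [hochschildD1, LinearMap.smul_apply, smul_add, smul_sub, mul_smul_comm,
      smul_mul_assoc]
  · rintro ⟨φ, hφ⟩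
    refine ⟨⟨φ + φ, fun a b => ?_⟩, fun a b => ?_⟩
    · rw [hφ]
      simp only [hochschildD1, LinearMap.add_apply, mul_comm b a]
      ring
    · rw [hφ]
      simp only [hochschildD1, mul_comm b a]
      ring

/-- Every element of `A` is the value at `f` of a primitive on the polynomial ring of a symmetric
cocycle of `A`. -/
theorem exists_symmetric_cocycle (hf : f ≠ 0) (g : CoordRing f) :
    ∃ (ψ : cocycle2 k (CoordRing f)) (φ : MvPolynomial (Fin d) k →ₗ[k] CoordRing f),
      φ f = g ∧ (∀ a b, ψ.1 a b = ψ.1 b a) ∧ ∀ p q, ψ.1 (toCoordRing f p) (toCoordRing f q) =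
        toCoordRing f p * φ q - φ (p * q) + φ p * toCoordRing f q := by
  have hφ : ∃ φ : MvPolynomial (Fin d) k →ₗ[k] CoordRing f,
      ∀ p, φ (p * f) = toCoordRing f p * g := by
    -- Multiplication by `f` is injective, so "divide by `f`" extends to a `k`-linear map `l` on all
    -- of `P`.
    have hinj : LinearMap.ker (LinearMap.mulRight k f) = ⊥ :=
      LinearMap.ker_eq_bot.2 (mul_left_injective₀ hf)
    obtain ⟨l, hl⟩ := (LinearMap.mulRight k f).exists_leftInverse_of_injective hinj
    refine ⟨LinearMap.mulRight k g ∘ₗ (toCoordRing f).toLinearMap ∘ₗ l, fun p => ?_⟩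
    have : l (p * f) = p := congrArg (fun F => F p) hl
    simp [this]
  obtain ⟨φ, hφ⟩ := hφ
  let s := Function.surjInv (toCoordRing_surjective f)
  have hs (a) : toCoordRing f (s a) = a := Function.surjInv_eq (toCoordRing_surjective f) a
  let Φ (p q : MvPolynomial (Fin d) k) : CoordRing f :=
    toCoordRing f p * φ q - φ (p * q) + φ p * toCoordRing f q
  have hsymm (p q) : Φ p q = Φ q p := by simp only [Φ, mul_comm q p]; ring
  -- Changing `q` by `r * f` contributes `p r g - p r g = 0`, by the prescribed values of `φ` on
  -- `(f)`; so the differential of `φ` descends to `A` even though `φ` need not.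
  have hright (p q q') (h : toCoordRing f q = toCoordRing f q') : Φ p q = Φ p q' := by
    obtain ⟨r, rfl⟩ := (toCoordRing_eq_iff f).1 h
    simp only [Φ, mul_add, map_add, ← mul_assoc, hφ, map_mul, toCoordRing_self]
    ring
  have hcongr (p p' q q') (h : toCoordRing f p = toCoordRing f p')
      (h' : toCoordRing f q = toCoordRing f q') : Φ p q = Φ p' q' := by
    rw [hright p q q' h', hsymm, hright q' p p' h, hsymm]
  let ψ (a b : CoordRing f) : CoordRing f := Φ (s a) (s b)
  have hψ (p q) : ψ (toCoordRing f p) (toCoordRing f q) = Φ p q := hcongr _ _ _ _ (hs _) (hs _)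
  have hψsymm (a b) : ψ a b = ψ b a := hsymm _ _
  have hlin (a) : IsLinearMap k (ψ a) := by
    obtain ⟨p, rfl⟩ := toCoordRing_surjective f a
    refine ⟨fun b c => ?_, fun r b => ?_⟩
    · obtain ⟨q, rfl⟩ := toCoordRing_surjective f b
      obtain ⟨q', rfl⟩ := toCoordRing_surjective f c
      rw [← map_add, hψ, hψ, hψ]
      simp only [Φ, mul_add, map_add]
      ring
    · obtain ⟨q, rfl⟩ := toCoordRing_surjective f b
      rw [← map_smul, hψ, hψ]
      simp only [Φ, mul_smul_comm, map_smul, smul_add, smul_sub]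
  refine ⟨⟨ψ, ⟨hlin, fun b => ?_⟩, fun a b c => ?_⟩, φ, ?_, hψsymm, hψ⟩
  · simpa only [hψsymm _ b] using hlin b
  · obtain ⟨p, rfl⟩ := toCoordRing_surjective f a
    obtain ⟨q, rfl⟩ := toCoordRing_surjective f b
    obtain ⟨r, rfl⟩ := toCoordRing_surjective f c
    rw [hochschildD2, ← map_mul, ← map_mul, hψ, hψ, hψ, hψ]
    simp only [Φ, map_mul, mul_assoc]
    ring
  · simpa using hφ 1

/-- Every element of `moduleN` is the matrix of coefficients of an alternating biderivation. -/
theorem exists_alternating_cocycle {a : Fin d → Fin d → CoordRing f} (ha : a ∈ moduleN f) :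
    ∃ ψ : cocycle2 k (CoordRing f), (∀ x y, ψ.1 x y = -ψ.1 y x) ∧
      ∀ m i, ψ.1 (toCoordRing f (X m)) (toCoordRing f (X i)) = a m i - a i m := by
  let s := Function.surjInv (toCoordRing_surjective f)
  have hs (a) : toCoordRing f (s a) = a := Function.surjInv_eq (toCoordRing_surjective f) a
  let D (i : Fin d) (p : MvPolynomial (Fin d) k) : CoordRing f := toCoordRing f (pderiv i p)
  have hDadd (i p q) : D i (p + q) = D i p + D i q := by simp only [D, map_add]
  have hDsmul (i) (r : k) (p) : D i (r • p) = r • D i p := by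
    simp only [D, Derivation.map_smul, map_smul]
  have hDmul (i p q) : D i (p * q) = toCoordRing f p * D i q + toCoordRing f q * D i p := by
    simp only [D, Derivation.leibniz, smul_eq_mul, map_add, map_mul]
  let Φ (p q : MvPolynomial (Fin d) k) : CoordRing f :=
    ∑ m, (∑ i, (a m i - a i m) * D i q) * D m p
  have halt (p q) : Φ p q = -Φ q p := by
    simp only [Φ, Finset.sum_mul, ← Finset.sum_neg_distrib]
    rw [Finset.sum_comm]
    exact Finset.sum_congr rfl fun i _ => Finset.sum_congr rfl fun m _ => by ring
  have hadd (p q q') : Φ p (q + q') = Φ p q + Φ p q' := by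
    simp only [Φ, hDadd, mul_add, Finset.sum_add_distrib, add_mul]
  have hsmul (p) (r : k) (q) : Φ p (r • q) = r • Φ p q := by
    simp only [Φ, hDsmul, mul_smul_comm, ← Finset.smul_sum, smul_mul_assoc]
  have hmul (p q q') :
      Φ p (q * q') = toCoordRing f q * Φ p q' + toCoordRing f q' * Φ p q := by
    simp only [Φ, hDmul, Finset.mul_sum, Finset.sum_mul, ← Finset.sum_add_distrib]
    exact Finset.sum_congr rfl fun m _ => Finset.sum_congr rfl fun i _ => by ring
  -- The relations defining `moduleN` say that the biderivation kills `f`, which lets it descend to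
  -- `A`.
  have hself (p) : Φ p f = 0 := Finset.sum_eq_zero fun m _ => by
    have : ∑ i, (a m i - a i m) * D i f = 0 := ha.2 m
    rw [this, zero_mul]
  have hright (p q q') (h : toCoordRing f q = toCoordRing f q') : Φ p q = Φ p q' := by
    obtain ⟨r, rfl⟩ := (toCoordRing_eq_iff f).1 h
    rw [hadd, hmul, hself, toCoordRing_self, mul_zero, zero_mul, add_zero, add_zero]
  have hcongr (p p' q q') (h : toCoordRing f p = toCoordRing f p')
      (h' : toCoordRing f q = toCoordRing f q') : Φ p q = Φ p' q' := by
    rw [hright p q q' h', halt, hright q' p p' h, ← halt]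
  let ψ (a b : CoordRing f) : CoordRing f := Φ (s a) (s b)
  have hψ (p q) : ψ (toCoordRing f p) (toCoordRing f q) = Φ p q := hcongr _ _ _ _ (hs _) (hs _)
  have hψalt (a b) : ψ a b = -ψ b a := halt _ _
  have hlin (a) : IsLinearMap k (ψ a) := by
    obtain ⟨p, rfl⟩ := toCoordRing_surjective f a
    refine ⟨fun b c => ?_, fun r b => ?_⟩
    · obtain ⟨q, rfl⟩ := toCoordRing_surjective f b
      obtain ⟨q', rfl⟩ := toCoordRing_surjective f c
      rw [← map_add, hψ, hψ, hψ, hadd]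
    · obtain ⟨q, rfl⟩ := toCoordRing_surjective f b
      rw [← map_smul, hψ, hψ, hsmul]
  refine ⟨⟨ψ, ⟨hlin, fun b => ?_⟩, fun a b c => ?_⟩, hψalt, fun m i => ?_⟩
  · refine ⟨fun x y => ?_, fun r x => ?_⟩
    · rw [hψalt, (hlin b).map_add, neg_add, ← hψalt, ← hψalt]
    · rw [hψalt, (hlin b).map_smul, ← smul_neg, ← hψalt]
  · obtain ⟨p, rfl⟩ := toCoordRing_surjective f a
    obtain ⟨q, rfl⟩ := toCoordRing_surjective f b
    obtain ⟨r, rfl⟩ := toCoordRing_surjective f c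
    rw [hochschildD2, ← map_mul, ← map_mul, hψ, hψ, hψ, hψ, halt (p * q) r, hmul, hmul,
      halt r p, halt r q]
    ring
  · change ψ (toCoordRing f (X m)) (toCoordRing f (X i)) = _
    rw [hψ]
    simp only [Φ, D]
    rw [Finset.sum_eq_single m, Finset.sum_eq_single i]
    · simp
    · intro j _ hj
      simp [pderiv_X_of_ne hj.symm]
    · simp
    · intro j _ hj
      simp [pderiv_X_of_ne hj.symm]
    · simp

theorem obstructionClass_prod_antisymmPart_surjective [CharZero k] (hf : f ≠ 0) :
    Function.Surjective
      ((obstructionClass (f := f)).prod (antisymmPart (f := f))) := by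
  have hhalf (a : CoordRing f) : (2⁻¹ : k) • a + (2⁻¹ : k) • a = a := by
    rw [← add_smul, ← two_mul, mul_inv_cancel₀ two_ne_zero, one_smul]
  rintro ⟨c, a, ha⟩
  obtain ⟨g, rfl⟩ := Submodule.Quotient.mk_surjective _ c
  -- The halves compensate for the unnormalized symmetrization and antisymmetrization in the two
  -- invariants, each of which doubles.
  obtain ⟨ψ₁, φ, hφ, hsymm, hψ₁⟩ := exists_symmetric_cocycle hf ((2⁻¹ : k) • g)
  obtain ⟨ψ₂, halt, hψ₂⟩ := exists_alternating_cocycle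
    (Submodule.smul_of_tower_mem (moduleN f) (2⁻¹ : k) ha)
  refine ⟨ψ₁ + ψ₂, ?_⟩
  have h₁ : antisymmPart ψ₁ = 0 := (antisymmPart_eq_zero_iff ψ₁).2 hsymm
  have h₂ : obstructionClass ψ₂ = 0 :=
    (obstructionClass_eq_zero_iff_exists_hochschildD1 ψ₂).2
      ⟨0, fun x y => by simp [halt x y, hochschildD1]⟩
  rw [LinearMap.prod_apply, Function.prod_apply, map_add, map_add, h₁, h₂, zero_add, add_zero]
  refine Prod.ext ?_ (Subtype.ext (funext fun j => funext fun i => ?_))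
  · rw [obstructionClass_eq ψ₁ (φ := φ + φ), LinearMap.add_apply, hφ, hhalf]
    intro p q
    rw [← hsymm (toCoordRing f p), hψ₁]
    simp only [LinearMap.add_apply]
    ring
  · change antisymmCoeff ψ₂.1 j i = a j i
    unfold antisymmCoeff
    split_ifs with h
    · rw [hψ₂, hψ₂]
      simp only [Pi.smul_apply, ha.1 i j h.le, smul_zero]
      rw [sub_zero, zero_sub, sub_neg_eq_add, hhalf]
    · rw [ha.1 j i (not_lt.1 h)]

end Hypersurface

end HypersurfaceHH

theorem lemma2p9 {k : Type*} [Field k] [IsAlgClosed k] [CharZero k] (d : ℕ)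
    (f : MvPolynomial (Fin d) k) (hf : 2 ≤ f.totalDegree) :
    Nonempty (HypersurfaceHH.HH2 k (HypersurfaceHH.CoordRing f) ≃ₗ[HypersurfaceHH.CoordRing f]
      (HypersurfaceHH.CoordRing f ⧸ HypersurfaceHH.jacobianIdeal f) ×
        HypersurfaceHH.moduleN f) := by
  have hf0 : f ≠ 0 := by
    rintro rfl
    simp at hf
  exact ⟨(Submodule.quotEquivOfEq _ _ (Submodule.ext fun ψ =>
    (HypersurfaceHH.mem_ker_iff_mem_coboundary2 ψ).symm)).trans
      (LinearMap.quotKerEquivOfSurjective _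
        (HypersurfaceHH.obstructionClass_prod_antisymmPart_surjective hf0))⟩
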